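/- Let $(V,\langle\cdot,\cdot\rangle)$ be a finite-dimensional Euclidean space and $\mathfrak R\subset V$ an irreducible reduced crystallographic root system spanning $V$, with simple roots $\alpha_1,\dots,\alpha_l$, highest root $\alpha_{\max}$, and coroots $\alpha^\vee=2\alpha/\langle\alpha,\alpha\rangle$. Let $W$ be the Weyl group, let $\Lambda=\sum_{\alpha\in\mathfrak R}\mathbb Z\alpha^\vee$ be the coroot lattice acting on $V$ by translations, let $W^{\mathrm{aff}}=\Lambda\rtimes W$ be the affine Weyl group, acting on $V$ by affine transformations, and let $$A=\{x\in V:\ \langle\alpha_i,x\rangle>0\ (i=1,\dots,l),\ \langle\alpha_{\max},x\rangle<1\}$$ be the open Weyl alcove. For $S\in\operatorname{End}(V)$ and $w\in W^{\mathrm{aff}}$ put $V_w^{(S)}=(S-w)(A)=\{Sx-w(x):x\in A\}$. (a) If the operator norm satisfies $\|S\|<1$, then each $V_w^{(S)}$, $w\in W^{\mathrm{aff}}$, is the interior of an $l$-dimensional simplex (where $l=\dim V$), the sets $V_w^{(S)}$ for distinct $w\in W^{\mathrm{aff}}$ are disjoint, and their closures cover $V$: $$V=\bigcup_{w\in W^{\mathrm{aff}}}\overline{V_w^{(S)}}.$$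 (b) For $S=0$ the resulting decomposition is given by the Stiefel diagram: the sets $V_w^{(0)}$, $w\in W^{\mathrm{aff}}$, are exactly the connected components of the complement in $V$ of the union of all affine hyperplanes $\{x:\langle\alpha,x\rangle=k\}$, $\alpha\in\mathfrak R$, $k\in\mathbb Z$. (c) For $S=\tau\cdot\mathrm{id}$ with $\tau\to 1$, $\tau<1$, the tiles $V_w^{(\tau\,\mathrm{id})}$ converge in Hausdorff distance, uniformly in $w\in W^{\mathrm{aff}}$, to the sets $V_w=(\mathrm{id}-w)(A)$. -/

import Mathlib

open scoped InnerProductSpace Topology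

namespace RootPairing

section General

variable {ι M N : Type*} [AddCommGroup M] [Module ℝ M] [AddCommGroup N] [Module ℝ N]

/-- The (finite) Weyl group, acting linearly on the space of coweights; it is generated by the
reflections `x ↦ x - ⟨α, x⟩ α^∨`. -/
def weylGroupOnCoweights (P : RootPairing ι ℝ M N) : Subgroup (N ≃ₗ[ℝ] N) :=
  Subgroup.closure (Set.range P.coreflection)

lemma coreflection_mem_corootLattice (P : RootPairing ι ℝ M N) [P.IsCrystallographic]
    (i : ι) {x : N} (hx : x ∈ P.corootSpan ℤ) : P.coreflection i x ∈ P.corootSpan ℤ := by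
  induction hx using Submodule.span_induction with
  | mem x hx =>
    obtain ⟨j, rfl⟩ := hx
    rw [← P.coroot_reflectionPerm]
    exact Submodule.subset_span ⟨_, rfl⟩
  | zero => simp
  | add x y _ _ hx hy => rw [map_add]; exact add_mem hx hy
  | smul n x _ hx => rw [map_zsmul]; exact Submodule.smul_mem _ n hx

lemma weylGroup_mem_corootLattice (P : RootPairing ι ℝ M N) [P.IsCrystallographic]
    {g : N ≃ₗ[ℝ] N} (hg : g ∈ P.weylGroupOnCoweights) :
    ∀ x ∈ P.corootSpan ℤ, g x ∈ P.corootSpan ℤ := by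
  unfold weylGroupOnCoweights at hg
  induction hg using Subgroup.closure_induction'' with
  | mem g hg =>
    obtain ⟨i, rfl⟩ := hg
    exact fun x hx => P.coreflection_mem_corootLattice i hx
  | inv_mem g hg =>
    obtain ⟨i, rfl⟩ := hg
    intro x hx
    have h : (P.coreflection i)⁻¹ = P.coreflection i := P.coreflection_inv i
    rw [h]
    exact P.coreflection_mem_corootLattice i hx
  | one => exact fun x hx => hx
  | mul g h _ _ hg hh => exact fun x hx => hg _ (hh x hx)

/-- The affine Weyl group: all affine transformations `x ↦ v x + l` with `v` in the Weyl group and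
`l` in the coroot lattice (the integral span of the coroots). -/
def affineWeylGroup (P : RootPairing ι ℝ M N) [P.IsCrystallographic] :
    Subgroup (N ≃ᵃ[ℝ] N) where
  carrier := {w | w.linear ∈ P.weylGroupOnCoweights ∧ w 0 ∈ P.corootSpan ℤ}
  one_mem' := ⟨one_mem P.weylGroupOnCoweights, zero_mem (P.corootSpan ℤ)⟩
  mul_mem' := by
    rintro g h ⟨hg, hg0⟩ ⟨hh, hh0⟩
    refine ⟨mul_mem hg hh, ?_⟩
    have key : (g * h) 0 = g.linear (h 0) + g 0 := by
      simpa using g.map_vadd 0 (h 0)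
    rw [key]
    exact add_mem (P.weylGroup_mem_corootLattice hg _ hh0) hg0
  inv_mem' := by
    rintro g ⟨hg, hg0⟩
    have hi : g.linear⁻¹ ∈ P.weylGroupOnCoweights := inv_mem hg
    refine ⟨hi, ?_⟩
    have key : g⁻¹ 0 = -(g.linear⁻¹ (g 0)) := by
      apply g.injective
      have h1 : g (g⁻¹ 0) = 0 := g.apply_symm_apply 0
      have h2 : g (-(g.linear⁻¹ (g 0))) = g.linear (-(g.linear⁻¹ (g 0))) + g 0 := by
        simpa using g.map_vadd 0 (-(g.linear⁻¹ (g 0)))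
      have h3 : g.linear (g.linear⁻¹ (g 0)) = g 0 := g.linear.apply_symm_apply (g 0)
      rw [h1, h2, map_neg, h3, neg_add_cancel]
    rw [key]
    exact neg_mem (P.weylGroup_mem_corootLattice hi _ hg0)

/-- `θ` is the highest root with respect to the base `b`: for every root `β`, the difference
`θ - β` is a sum of simple roots. -/
def IsHighestRoot {P : RootPairing ι ℝ M N} (b : P.Base) (θ : ι) : Prop :=
  ∀ i, P.root θ - P.root i ∈ AddSubmonoid.closure (P.root '' b.support)

end General

section Euclidean

variable {ι V : Type*} [NormedAddCommGroup V] [InnerProductSpace ℝ V]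

/-- The root pairing is that of a root system in the Euclidean space `V` in the classical sense:
the pairing between weights and coweights is the inner product, and the coroot of a root `α` is
`2 α / ⟨α, α⟩` (equivalently, the reflections are orthogonal). -/
structure IsEuclidean (P : RootPairing ι ℝ V V) : Prop where
  toLinearMap_apply : ∀ x y : V, P.toLinearMap x y = ⟪x, y⟫_ℝ
  coroot_eq : ∀ i, P.coroot i = (2 / ⟪P.root i, P.root i⟫_ℝ) • P.root i

/-- The open Weyl alcove
`{x | ⟨α_i, x⟩ > 0 for all simple roots α_i, and ⟨θ, x⟩ < 1}`, for `θ` the highest root. -/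
def alcove {P : RootPairing ι ℝ V V} (b : P.Base) (θ : ι) : Set V :=
  {x | (∀ i ∈ b.support, 0 < ⟪P.root i, x⟫_ℝ) ∧ ⟪P.root θ, x⟫_ℝ < 1}

/-- The tile `(S - w)(A)`, for `A` the open Weyl alcove. -/
def tile {P : RootPairing ι ℝ V V} (b : P.Base) (θ : ι) (S : V →L[ℝ] V) (w : V ≃ᵃ[ℝ] V) : Set V :=
  (fun x => S x - w x) '' alcove b θ

/-- The Stiefel diagram: the union of all affine hyperplanes `⟨α, x⟩ = k`, for `α` a root and
`k` an integer. -/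
def stiefelDiagram (P : RootPairing ι ℝ V V) : Set V :=
  {x | ∃ (i : ι) (k : ℤ), ⟪P.root i, x⟫_ℝ = k}

end Euclidean

end RootPairing

/-! The core is that folding `V` onto the closed alcove along the affine Weyl group is 1-Lipschitz:
for `x`, `y` in the closed alcove and any `w`, `w'` in the group, |x - y| ≤ |w x - w' y|
(`dist_le_dist_of_mem_closedAlcove`).

Disjointness: S x - w x = S y - w' y gives |w x - w' y| = |S (x - y)| ≤ ‖S‖ |x - y|, so x = y
because ‖S‖ < 1. Then w x = w' x, and w = w' because the action is free on the alcove. Covering: if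
π is the folding map, y ↦ S (π y) - v is a contraction. Its fixed point y = w (π y) gives v = S (π
y) - w (π y). Each tile is an injective affine image of the alcove, which is a simplex. For S = 0
the tiles are the sets -w(A), and the diagram is symmetric under the group and under negation. The
limit τ → 1 only uses that the alcove is bounded.

For the folding inequality, take `x`, `y` in the open alcove. A point of the orbit of `y` nearest to
`x` satisfies every wall inequality, since reflecting in a violated wall would bring it closer to
`x`. It therefore lies in the alcove, and freeness identifies it with `y`.

Freeness is the Coxeter argument for the affine roots ⟨α, ·⟩ - k. With 1 - θ as a wall besides the
simple roots, every affine root is, up to sign, a sum of wall roots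
(`affineRoot_mem_or_neg_mem_wallCone`). Hence a wall reflection changes the sign only of affine
roots proportional to its own, which gives generation by the wall reflections and the exchange
condition. -/

namespace RootPairing

/-! ### Affine roots and their reflections -/

section AffineRoots

variable {ι V : Type*} [NormedAddCommGroup V] [InnerProductSpace ℝ V]

/-- The affine root `x ↦ ⟨α, x⟩ - k`. -/
def affineRoot (P : RootPairing ι ℝ V V) (a : ι × ℤ) (x : V) : ℝ := ⟪P.root a.1, x⟫_ℝ - a.2

/-- The reflection in the zero set of an affine root. -/
def affineReflection (P : RootPairing ι ℝ V V) (a : ι × ℤ) : V ≃ᵃ[ℝ] V :=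
  (P.coreflection a.1).toAffineEquiv.trans (AffineEquiv.constVAdd ℝ V ((a.2 : ℝ) • P.coroot a.1))

/-- The affine roots which define the walls of the Weyl alcove. -/
def walls {P : RootPairing ι ℝ V V} (b : P.Base) (θ : ι) : Set (ι × ℤ) :=
  {a | a.1 ∈ b.support ∧ a.2 = 0} ∪ {(P.reflectionPerm θ θ, -1)}

/-- The closed Weyl alcove. -/
def closedAlcove {P : RootPairing ι ℝ V V} (b : P.Base) (θ : ι) : Set V :=
  {x | ∀ c ∈ walls b θ, 0 ≤ P.affineRoot c x}

/-- The sums of affine roots defining the walls. -/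
def wallCone {P : RootPairing ι ℝ V V} (b : P.Base) (θ : ι) : AddSubmonoid (V → ℝ) :=
  AddSubmonoid.closure (P.affineRoot '' walls b θ)

variable {P : RootPairing ι ℝ V V} {b : P.Base} {θ : ι}

lemma root_reflectionPerm_self (i : ι) : P.root (P.reflectionPerm i i) = -P.root i := by
  rw [root_reflectionPerm, reflection_apply_self]

lemma mem_alcove_iff {x : V} : x ∈ alcove b θ ↔ ∀ c ∈ walls b θ, 0 < P.affineRoot c x := by
  constructor
  · rintro ⟨h, h'⟩ ⟨i, k⟩ (⟨hi, hk⟩ | hc)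
    · obtain rfl : k = 0 := hk
      simpa [affineRoot] using h i hi
    · obtain ⟨rfl, rfl⟩ := Prod.mk.inj hc
      simp only [affineRoot, root_reflectionPerm_self, inner_neg_left]
      push_cast
      linarith
  · intro h
    refine ⟨fun i hi => by simpa [affineRoot] using h (i, 0) (Or.inl ⟨hi, rfl⟩), ?_⟩
    have := h _ (Or.inr rfl)
    simp only [affineRoot, root_reflectionPerm_self, inner_neg_left] at this
    push_cast at this
    linarith

lemma alcove_subset_closedAlcove : alcove b θ ⊆ closedAlcove b θ :=
  fun _ hx c hc => (mem_alcove_iff.1 hx c hc).le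

lemma continuous_affineRoot (a : ι × ℤ) : Continuous (P.affineRoot a) := by
  unfold affineRoot; fun_prop

lemma affineRoot_smul_add_smul (a : ι × ℤ) {s t : ℝ} (hst : s + t = 1) (x y : V) :
    P.affineRoot a (s • x + t • y) = s * P.affineRoot a x + t * P.affineRoot a y := by
  simp only [affineRoot, inner_add_right, inner_smul_right]
  linear_combination (a.2 : ℝ) * hst

lemma convex_alcove : Convex ℝ (alcove b θ) := by
  intro x hx y hy s t hs ht hst
  rw [mem_alcove_iff] at *
  intro c hc
  rw [affineRoot_smul_add_smul c hst]
  have h1 := hx c hc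
  have h2 := hy c hc
  rcases hs.eq_or_lt with rfl | hs
  · obtain rfl : t = 1 := by linarith
    simpa
  · positivity

lemma affineRoot_neg (i : ι) (k : ℤ) (x : V) :
    P.affineRoot (P.reflectionPerm i i, -k) x = -P.affineRoot (i, k) x := by
  simp only [affineRoot, root_reflectionPerm_self, inner_neg_left]
  push_cast
  ring

lemma exists_affineRoot_eq_neg (a : ι × ℤ) : ∃ a', P.affineRoot a' = -P.affineRoot a :=
  ⟨_, funext fun x => affineRoot_neg a.1 a.2 x⟩

lemma affineReflection_apply (hP : P.IsEuclidean) (a : ι × ℤ) (x : V) :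
    P.affineReflection a x = x - P.affineRoot a x • P.coroot a.1 := by
  simp only [affineReflection, affineRoot, AffineEquiv.trans_apply, LinearEquiv.coe_toAffineEquiv,
    AffineEquiv.constVAdd_apply, coreflection_apply, vadd_eq_add, root', sub_smul]
  rw [hP.toLinearMap_apply]
  abel

lemma inner_root_self_pos (P : RootPairing ι ℝ V V) (i : ι) : 0 < ⟪P.root i, P.root i⟫_ℝ :=
  real_inner_self_pos.2 (P.ne_zero i)

lemma inner_root_coroot (hP : P.IsEuclidean) (i j : ι) :
    ⟪P.root i, P.coroot j⟫_ℝ = P.pairing i j := by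
  rw [← hP.toLinearMap_apply]; rfl

lemma affineRoot_affineReflection (hP : P.IsEuclidean) (a c : ι × ℤ) (x : V) :
    P.affineRoot a (P.affineReflection c x) =
      P.affineRoot a x - P.pairing a.1 c.1 * P.affineRoot c x := by
  rw [affineReflection_apply hP, ← inner_root_coroot hP]
  simp only [affineRoot, inner_sub_right, inner_smul_right]
  ring

lemma affineRoot_affineReflection_self (hP : P.IsEuclidean) (a : ι × ℤ) (x : V) :
    P.affineRoot a (P.affineReflection a x) = -P.affineRoot a x := by
  rw [affineRoot_affineReflection hP, pairing_same]; ring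

lemma affineReflection_mul_self (hP : P.IsEuclidean) (a : ι × ℤ) :
    P.affineReflection a * P.affineReflection a = 1 := by
  ext x
  change P.affineReflection a (P.affineReflection a x) = x
  rw [affineReflection_apply hP, affineRoot_affineReflection_self hP, affineReflection_apply hP]
  simp

lemma affineReflection_inv (hP : P.IsEuclidean) (a : ι × ℤ) :
    (P.affineReflection a)⁻¹ = P.affineReflection a :=
  inv_eq_of_mul_eq_one_left (affineReflection_mul_self hP a)

lemma inner_coreflection (hP : P.IsEuclidean) (i : ι) (x y : V) :
    ⟪P.coreflection i x, P.coreflection i y⟫_ℝ = ⟪x, y⟫_ℝ := by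
  have h := (inner_root_self_pos P i).ne'
  simp only [coreflection_apply, root', hP.toLinearMap_apply, hP.coroot_eq, inner_sub_left,
    inner_sub_right, inner_smul_left, inner_smul_right, real_inner_comm (P.root i) x]
  simp only [conj_trivial]
  field_simp
  ring

lemma dist_affineReflection (hP : P.IsEuclidean) (a : ι × ℤ) (x y : V) :
    dist (P.affineReflection a x) (P.affineReflection a y) = dist x y := by
  simp only [affineReflection, AffineEquiv.trans_apply, LinearEquiv.coe_toAffineEquiv,
    AffineEquiv.constVAdd_apply, dist_vadd_cancel_left]
  rw [dist_eq_norm, dist_eq_norm, ← map_sub, norm_eq_sqrt_real_inner,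
    norm_eq_sqrt_real_inner (x - y), inner_coreflection hP]

/-- Two affine roots which are proportional have the same reflection. -/
lemma affineReflection_eq_of_affineRoot_eq_smul (hP : P.IsEuclidean) {a c : ι × ℤ} {t : ℝ}
    (h : P.affineRoot a = t • P.affineRoot c) :
    P.affineReflection a = P.affineReflection c := by
  have h0 := congrFun h 0
  have hx : P.root a.1 = t • P.root c.1 := by
    refine ext_inner_right ℝ fun v => ?_
    have := congrFun h v
    simp only [affineRoot, Pi.smul_apply, smul_eq_mul, inner_zero_right] at this h0
    rw [inner_smul_left]
    simp only [conj_trivial]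
    linarith
  have ht : t ≠ 0 := by
    rintro rfl
    exact P.ne_zero a.1 (by simpa using hx)
  ext x
  rw [affineReflection_apply hP, affineReflection_apply hP, hP.coroot_eq, hP.coroot_eq, hx, h]
  have := (inner_root_self_pos P c.1).ne'
  simp only [Pi.smul_apply, smul_eq_mul, inner_smul_left, inner_smul_right, smul_smul,
    conj_trivial]
  congr 2
  field_simp

/-- An affine reflection permutes the affine roots. -/
lemma exists_affineRoot_comp_affineReflection [P.IsCrystallographic] (hP : P.IsEuclidean)
    (a c : ι × ℤ) : ∃ a', ∀ x, P.affineRoot a' x = P.affineRoot a (P.affineReflection c x) := by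
  obtain ⟨z, hz⟩ := P.exists_value (S := ℤ) a.1 c.1
  simp only [algebraMap_int_eq, eq_intCast] at hz
  -- With z the integral pairing, a - z c has linear part s_c(α) and level k_a - z k_c.
  refine ⟨(P.reflectionPerm c.1 a.1, a.2 - z * c.2), fun x => ?_⟩
  rw [affineRoot_affineReflection hP]
  simp only [affineRoot, root_reflectionPerm, reflection_apply_root, inner_sub_left,
    inner_smul_left, conj_trivial, ← hz]
  push_cast
  ring

/-- The reflection of a reflected affine root is the conjugate of the reflection. -/
lemma affineReflection_conj (hP : P.IsEuclidean) {a a' c : ι × ℤ}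
    (h : ∀ x, P.affineRoot a' x = P.affineRoot a (P.affineReflection c x)) :
    P.affineReflection a' = P.affineReflection c * P.affineReflection a * P.affineReflection c := by
  have hr : P.root a'.1 = P.coreflection c.1 (P.root a.1) := by
    refine ext_inner_right ℝ fun v => ?_
    have h1 := h v
    have h2 := h 0
    rw [affineRoot_affineReflection hP] at h1 h2
    simp only [affineRoot, inner_zero_right] at h1 h2
    rw [← inner_root_coroot hP] at h1 h2
    simp only [coreflection_apply, root', hP.toLinearMap_apply, inner_sub_left, inner_smul_left,
      conj_trivial, hP.coroot_eq, inner_smul_right, real_inner_comm (P.root a.1)] at h1 h2 ⊢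
    linear_combination h1 - h2
  have hc : P.coroot a'.1 = P.coreflection c.1 (P.coroot a.1) := by
    rw [hP.coroot_eq, hP.coroot_eq, hr, inner_coreflection hP, map_smul]
  ext x
  change _ = P.affineReflection c (P.affineReflection a (P.affineReflection c x))
  have h3 : ∀ (y v : V), P.affineReflection c (y - v) =
      P.affineReflection c y - P.coreflection c.1 v := by
    intro y v
    simp only [affineReflection, AffineEquiv.trans_apply, LinearEquiv.coe_toAffineEquiv,
      AffineEquiv.constVAdd_apply, map_sub, vadd_eq_add]
    abel
  rw [affineReflection_apply hP a' x, affineReflection_apply hP a, h3, map_smul, ← hc, h]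
  congr 1
  exact (DFunLike.congr_fun (affineReflection_mul_self hP c) x).symm

end AffineRoots

/-! ### Positivity of affine roots and points of the alcove -/

section Alcove

variable {ι V : Type*} [NormedAddCommGroup V] [InnerProductSpace ℝ V]
  {P : RootPairing ι ℝ V V} {b : P.Base} {θ : ι}

lemma inner_mem_wallCone {v : V} (hv : v ∈ AddSubmonoid.closure (P.root '' b.support)) :
    (fun x => ⟪v, x⟫_ℝ) ∈ wallCone b θ := by
  induction hv using AddSubmonoid.closure_induction with
  | mem v hv =>
    obtain ⟨i, hi, rfl⟩ := hv
    refine AddSubmonoid.subset_closure ⟨(i, 0), Or.inl ⟨hi, rfl⟩, ?_⟩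
    ext x
    simp [affineRoot]
  | zero =>
    simp only [inner_zero_left]
    exact zero_mem (wallCone b θ)
  | add v w _ _ hv hw =>
    simp only [inner_add_left]
    exact add_mem hv hw

lemma one_sub_inner_mem_wallCone :
    (fun x => 1 - ⟪P.root θ, x⟫_ℝ) ∈ wallCone b θ := by
  refine AddSubmonoid.subset_closure ⟨_, Or.inr rfl, ?_⟩
  ext x
  simp only [affineRoot, root_reflectionPerm_self, inner_neg_left]
  push_cast
  ring

lemma IsHighestRoot.add_mem_closure (hθ : IsHighestRoot b θ) (i : ι) :
    P.root θ + P.root i ∈ AddSubmonoid.closure (P.root '' b.support) := by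
  simpa [root_reflectionPerm_self] using hθ (P.reflectionPerm i i)

/-- If instead -θ is a sum of simple roots, add it to 2θ, which is one by the previous lemma. -/
lemma IsHighestRoot.mem_closure (hθ : IsHighestRoot b θ) :
    P.root θ ∈ AddSubmonoid.closure (P.root '' b.support) := by
  rcases b.root_mem_or_neg_mem θ with h | h
  · exact h
  · simpa using add_mem (hθ.add_mem_closure θ) h

/-- α + (n + 1) = (n + 1)(1 - θ) + n θ + (θ + α), and each summand is a sum of wall roots. -/
lemma inner_add_natCast_mem_wallCone (hθ : IsHighestRoot b θ) (i : ι) (n : ℕ) :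
    (fun x => ⟪P.root i, x⟫_ℝ + (n + 1)) ∈ wallCone b θ := by
  have h1 : (fun x => 1 - ⟪P.root θ, x⟫_ℝ) ∈ wallCone b θ := one_sub_inner_mem_wallCone
  have h2 : (fun x => ⟪P.root θ, x⟫_ℝ) ∈ wallCone b θ := inner_mem_wallCone hθ.mem_closure
  have h3 : (fun x => ⟪P.root θ + P.root i, x⟫_ℝ) ∈ wallCone b θ :=
    inner_mem_wallCone (hθ.add_mem_closure i)
  convert add_mem (add_mem (nsmul_mem h1 (n + 1)) (nsmul_mem h2 n)) h3 using 1
  ext x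
  simp only [Pi.add_apply, Pi.smul_apply, inner_add_left]
  rw [nsmul_eq_mul, nsmul_eq_mul]
  push_cast
  ring

/-- Every affine root is nonnegative or nonpositive on the alcove, for algebraic reasons. -/
lemma affineRoot_mem_or_neg_mem_wallCone (hθ : IsHighestRoot b θ) (a : ι × ℤ) :
    P.affineRoot a ∈ wallCone b θ ∨ -P.affineRoot a ∈ wallCone b θ := by
  obtain ⟨i, k⟩ := a
  rcases lt_trichotomy k 0 with hk | rfl | hk
  · left
    obtain ⟨n, hn⟩ := Int.eq_ofNat_of_zero_le (show 0 ≤ -k - 1 by omega)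
    convert inner_add_natCast_mem_wallCone hθ i n using 1
    ext x
    have : (k : ℝ) = -(n + 1) := by exact_mod_cast (by omega : k = -((n : ℤ) + 1))
    simp only [affineRoot, this]
    ring
  · refine (b.root_mem_or_neg_mem i).imp (fun h => ?_) (fun h => ?_)
    · convert inner_mem_wallCone h using 1
      ext x
      simp [affineRoot]
    · convert inner_mem_wallCone h using 1
      ext x
      simp [affineRoot]
  · right
    obtain ⟨n, hn⟩ := Int.eq_ofNat_of_zero_le (show 0 ≤ k - 1 by omega)
    convert inner_add_natCast_mem_wallCone hθ (P.reflectionPerm i i) n using 1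
    ext x
    have : (k : ℝ) = n + 1 := by exact_mod_cast (by omega : k = (n : ℤ) + 1)
    simp only [affineRoot, this, root_reflectionPerm_self, Pi.neg_apply, inner_neg_left]
    ring

lemma nonneg_of_mem_wallCone {f : V → ℝ} (hf : f ∈ wallCone b θ) {x : V}
    (hx : x ∈ closedAlcove b θ) : 0 ≤ f x := by
  induction hf using AddSubmonoid.closure_induction with
  | mem f hf => obtain ⟨c, hc, rfl⟩ := hf; exact hx c hc
  | zero => exact le_rfl
  | add f g _ _ hf hg => exact add_nonneg hf hg

lemma eq_zero_or_pos_of_mem_wallCone {f : V → ℝ} (hf : f ∈ wallCone b θ) {x : V}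
    (hx : x ∈ alcove b θ) : f = 0 ∨ 0 < f x := by
  induction hf using AddSubmonoid.closure_induction with
  | mem f hf => obtain ⟨c, hc, rfl⟩ := hf; exact Or.inr (mem_alcove_iff.1 hx c hc)
  | zero => exact Or.inl rfl
  | add f g _ _ hf hg =>
    rcases hf with rfl | hf
    · simpa using hg
    · rcases hg with rfl | hg
      · right; simpa using hf
      · exact Or.inr (add_pos hf hg)

lemma affineRoot_ne_zero (P : RootPairing ι ℝ V V) (a : ι × ℤ) : P.affineRoot a ≠ 0 := by
  intro h
  have h0 := congrFun h 0
  have h1 := congrFun h (P.root a.1)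
  simp only [affineRoot, inner_zero_right, Pi.zero_apply] at h0 h1
  have := inner_root_self_pos P a.1
  linarith

lemma affineRoot_pos_of_mem_wallCone {a : ι × ℤ} (ha : P.affineRoot a ∈ wallCone b θ) {x : V}
    (hx : x ∈ alcove b θ) : 0 < P.affineRoot a x :=
  (eq_zero_or_pos_of_mem_wallCone ha hx).resolve_left (affineRoot_ne_zero P a)

lemma affineRoot_neg_of_neg_mem_wallCone {a : ι × ℤ} (ha : -P.affineRoot a ∈ wallCone b θ) {x : V}
    (hx : x ∈ alcove b θ) : P.affineRoot a x < 0 := by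
  have := (eq_zero_or_pos_of_mem_wallCone ha hx).resolve_left
    (neg_ne_zero.2 (affineRoot_ne_zero P a))
  simpa using this

lemma affineRoot_ne_zero_of_mem_alcove (hθ : IsHighestRoot b θ) (a : ι × ℤ) {x : V}
    (hx : x ∈ alcove b θ) : P.affineRoot a x ≠ 0 := by
  rcases affineRoot_mem_or_neg_mem_wallCone hθ a with h | h
  · exact (affineRoot_pos_of_mem_wallCone h hx).ne'
  · exact (affineRoot_neg_of_neg_mem_wallCone h hx).ne

lemma mem_wallCone_of_pos (hθ : IsHighestRoot b θ) {a : ι × ℤ} {x : V}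
    (hx : x ∈ alcove b θ) (h : 0 < P.affineRoot a x) : P.affineRoot a ∈ wallCone b θ :=
  (affineRoot_mem_or_neg_mem_wallCone hθ a).resolve_right
    fun h' => (affineRoot_neg_of_neg_mem_wallCone h' hx).not_gt h

/-- At a point in the relative interior of the facet of `c`, any summand other than `c` contributes
a positive amount, so vanishing there leaves only copies of `c`. -/
lemma eq_nsmul_of_mem_wallCone {c : ι × ℤ} {f : V → ℝ} (hf : f ∈ wallCone b θ) {x : V}
    (hcx : P.affineRoot c x = 0) (hx : ∀ d ∈ walls b θ, d ≠ c → 0 < P.affineRoot d x) :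
    0 ≤ f x ∧ (f x = 0 → ∃ n : ℕ, f = n • P.affineRoot c) := by
  induction hf using AddSubmonoid.closure_induction with
  | mem f hf =>
    obtain ⟨d, hd, rfl⟩ := hf
    by_cases hdc : d = c
    · subst hdc
      exact ⟨hcx.ge, fun _ => ⟨1, by simp⟩⟩
    · exact ⟨(hx d hd hdc).le, fun h => absurd h (hx d hd hdc).ne'⟩
  | zero => exact ⟨le_rfl, fun _ => ⟨0, by simp⟩⟩
  | add f g _ _ hf hg =>
    refine ⟨add_nonneg hf.1 hg.1, fun h => ?_⟩
    obtain ⟨h1, h2⟩ := (add_eq_zero_iff_of_nonneg hf.1 hg.1).1 h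
    obtain ⟨n, rfl⟩ := hf.2 h1
    obtain ⟨m, rfl⟩ := hg.2 h2
    exact ⟨n + m, (add_smul ..).symm⟩

/-- The dual coordinates: a point is prescribed by the values of the simple roots. -/
lemma exists_inner_root_eq [FiniteDimensional ℝ V] [P.IsRootSystem] (u : b.support → ℝ) :
    ∃ x : V, ∀ i : b.support, ⟪P.root i, x⟫_ℝ = u i := by
  let f : V →L[ℝ] ℝ := LinearMap.toContinuousLinearMap (b.toWeightBasis.constr ℝ u)
  refine ⟨(InnerProductSpace.toDual ℝ V).symm f, fun i => ?_⟩
  rw [real_inner_comm, InnerProductSpace.toDual_symm_apply]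
  have := b.toWeightBasis.constr_basis ℝ u i
  simpa [f] using this

lemma eq_of_inner_root_eq [P.IsRootSystem] (b : P.Base) {x y : V}
    (h : ∀ i ∈ b.support, ⟪P.root i, x⟫_ℝ = ⟪P.root i, y⟫_ℝ) : x = y := by
  refine ext_inner_left ℝ fun v => ?_
  induction (b.toWeightBasis.mem_span v) using Submodule.span_induction with
  | mem v hv =>
    obtain ⟨i, rfl⟩ := hv
    simpa using h i i.2
  | zero => simp
  | add v w _ _ hv hw => rw [inner_add_left, inner_add_left, hv, hw]
  | smul t v _ hv => rw [inner_smul_left, inner_smul_left, hv]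

/-- θ - α_i is a sum of simple roots, so the coefficient of α_i in θ is at least 1. -/
lemma IsHighestRoot.exists_coeff [P.IsRootSystem] (hθ : IsHighestRoot b θ) :
    ∃ m : b.support → ℝ, (∀ i, 0 < m i) ∧ P.root θ = ∑ i, m i • P.root i := by
  classical
  refine ⟨fun i => b.toWeightBasis.repr (P.root θ) i, fun i => ?_, ?_⟩
  · have key : ∀ v ∈ AddSubmonoid.closure (P.root '' b.support),
        0 ≤ b.toWeightBasis.repr v i := by
      intro v hv
      induction hv using AddSubmonoid.closure_induction with
      | mem v hv =>
        obtain ⟨j, hj, rfl⟩ := hv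
        have : P.root j = b.toWeightBasis ⟨j, hj⟩ := by simp
        rw [this, Module.Basis.repr_self, Finsupp.single_apply]
        split_ifs <;> norm_num
      | zero => simp
      | add v w _ _ hv hw => simpa using add_nonneg hv hw
    have h := key _ (hθ i)
    have hi : P.root i = b.toWeightBasis i := by simp
    rw [map_sub, hi, Module.Basis.repr_self] at h
    simp only [Finsupp.sub_apply, Finsupp.single_eq_same] at h
    dsimp only
    linarith
  · conv_lhs => rw [← b.toWeightBasis.sum_repr (P.root θ)]
    simp

lemma affineRoot_highest (x : V) :
    P.affineRoot (P.reflectionPerm θ θ, -1) x = 1 - ⟪P.root θ, x⟫_ℝ := by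
  simp only [affineRoot, root_reflectionPerm_self, inner_neg_left]
  push_cast
  ring

lemma IsHighestRoot.exists_point [FiniteDimensional ℝ V] [P.IsRootSystem]
    (hθ : IsHighestRoot b θ) : ∃ m : b.support → ℝ, (∀ i, 0 < m i) ∧ 0 < ∑ i, m i ∧
      ∀ u : b.support → ℝ, ∃ x : V, (∀ i : b.support, P.affineRoot (i, 0) x = u i) ∧
        P.affineRoot (P.reflectionPerm θ θ, -1) x = 1 - ∑ i, m i * u i := by
  obtain ⟨m, hm, h⟩ := hθ.exists_coeff
  refine ⟨m, hm, ?_, fun u => ?_⟩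
  · have : Nonempty ι := ⟨θ⟩
    obtain ⟨i, hi⟩ := b.support_nonempty
    exact Finset.sum_pos (fun i _ => hm i) ⟨⟨i, hi⟩, Finset.mem_univ _⟩
  · obtain ⟨x, hx⟩ := exists_inner_root_eq u
    refine ⟨x, fun i => by simp [affineRoot, hx], ?_⟩
    rw [affineRoot_highest, h, sum_inner]
    simp [inner_smul_left, hx]

lemma exists_affineRoot_eq_of_mem_walls [FiniteDimensional ℝ V] [P.IsRootSystem]
    (hθ : IsHighestRoot b θ) :
    ∃ (x : V) (δ : ℝ), 0 < δ ∧ ∀ c ∈ walls b θ, P.affineRoot c x = δ := by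
  obtain ⟨m, hm, hM, h⟩ := hθ.exists_point
  -- The common value δ must solve δ = 1 - δ ∑ m_i.
  obtain ⟨x, hx, hx'⟩ := h fun _ => (1 + ∑ i, m i)⁻¹
  refine ⟨x, (1 + ∑ i, m i)⁻¹, by positivity, ?_⟩
  rintro ⟨i, k⟩ (⟨hi, hk⟩ | hd)
  · obtain rfl : k = 0 := hk
    exact hx ⟨i, hi⟩
  · obtain ⟨rfl, rfl⟩ := Prod.mk.inj hd
    rw [hx', ← Finset.sum_mul]
    field_simp
    ring

lemma alcove_nonempty [FiniteDimensional ℝ V] [P.IsRootSystem] (hθ : IsHighestRoot b θ) :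
    (alcove b θ).Nonempty := by
  obtain ⟨x, δ, hδ, h⟩ := exists_affineRoot_eq_of_mem_walls hθ
  exact ⟨x, mem_alcove_iff.2 fun c hc => hδ.trans_eq (h c hc).symm⟩

lemma exists_mem_wall [FiniteDimensional ℝ V] [P.IsRootSystem]
    (hθ : IsHighestRoot b θ) {c : ι × ℤ} (hc : c ∈ walls b θ) :
    ∃ x : V, P.affineRoot c x = 0 ∧ ∀ d ∈ walls b θ, d ≠ c → 0 < P.affineRoot d x := by
  classical
  obtain ⟨m, hm, hM, h⟩ := hθ.exists_point
  obtain ⟨j, k⟩ := c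
  rcases hc with ⟨hj, hk⟩ | hc
  · obtain rfl : k = 0 := hk
    -- Moving the equal-value point onto the wall α_j = 0 only increases 1 - θ.
    obtain ⟨x, hx, hx'⟩ := h fun i => if i = ⟨j, hj⟩ then 0 else (1 + ∑ i, m i)⁻¹
    refine ⟨x, by simpa using hx ⟨j, hj⟩, ?_⟩
    rintro ⟨i, k⟩ (⟨hi, hk⟩ | hd) hne
    · obtain rfl : k = 0 := hk
      rw [hx ⟨i, hi⟩, if_neg (by rintro ⟨⟩; exact hne rfl)]
      positivity
    · obtain ⟨rfl, rfl⟩ := Prod.mk.inj hd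
      rw [hx']
      have : ∑ i, m i * (if i = ⟨j, hj⟩ then 0 else (1 + ∑ i, m i)⁻¹)
          ≤ ∑ i, m i * (1 + ∑ i, m i)⁻¹ := by
        gcongr with i _
        · exact (hm i).le
        · split_ifs
          · positivity
          · exact le_rfl
      rw [← Finset.sum_mul, ← div_eq_mul_inv] at this
      have h2 : (∑ i, m i) / (1 + ∑ i, m i) < 1 := by
        rw [div_lt_one (by positivity)]; linarith
      linarith
  · obtain ⟨rfl, rfl⟩ := Prod.mk.inj hc
    obtain ⟨x, hx, hx'⟩ := h fun _ => (∑ i, m i)⁻¹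
    refine ⟨x, ?_, ?_⟩
    · rw [hx', ← Finset.sum_mul, mul_inv_cancel₀ hM.ne', sub_self]
    · rintro ⟨i, k⟩ (⟨hi, hk⟩ | hd) hne
      · obtain rfl : k = 0 := hk
        rw [hx ⟨i, hi⟩]
        positivity
      · exact absurd hd hne

/-- A reflection in a wall of the alcove permutes the positive affine roots, apart from those
which define the same wall. -/
lemma affineReflection_eq_of_sign_change [FiniteDimensional ℝ V] [P.IsRootSystem]
    [P.IsCrystallographic] (hP : P.IsEuclidean)
    (hθ : IsHighestRoot b θ) {a a' c : ι × ℤ} (hc : c ∈ walls b θ)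
    (h : ∀ x, P.affineRoot a' x = P.affineRoot a (P.affineReflection c x))
    (ha : P.affineRoot a ∈ wallCone b θ) (ha' : P.affineRoot a' ∉ wallCone b θ) :
    P.affineReflection a = P.affineReflection c := by
  obtain ⟨x, hcx, hx⟩ := exists_mem_wall hθ hc
  have hxc : x ∈ closedAlcove b θ := by
    intro d hd
    by_cases hdc : d = c
    · exact hdc ▸ hcx.ge
    · exact (hx d hd hdc).le
  -- The facet point x is fixed by the reflection, so `a` and `a'` agree there. One is nonnegative
  -- and the other nonpositive, so both vanish and `a` is a multiple of `c`.
  have h1 := nonneg_of_mem_wallCone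
    ((affineRoot_mem_or_neg_mem_wallCone hθ a').resolve_left ha') hxc
  have h2 : P.affineRoot a' x = P.affineRoot a x := by
    rw [h, affineReflection_apply hP, hcx]; simp
  obtain ⟨h3, h4⟩ := eq_nsmul_of_mem_wallCone ha hcx hx
  rw [Pi.neg_apply, h2] at h1
  obtain ⟨n, hn⟩ := h4 (by linarith)
  exact affineReflection_eq_of_affineRoot_eq_smul hP (t := n) (by rw [hn, Nat.cast_smul_eq_nsmul])

end Alcove

/-! ### Generation by wall reflections, exchange condition, free action -/

section AffineWeylGroup

variable {ι V : Type*} [NormedAddCommGroup V] [InnerProductSpace ℝ V]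
  {P : RootPairing ι ℝ V V} {b : P.Base} {θ : ι}

/-- Otherwise no wall root, hence no sum of them, would increase from 0 to α; but `a` itself
increases by ⟨α, α⟩. -/
lemma exists_mem_walls_pairing_pos (hP : P.IsEuclidean) {a : ι × ℤ}
    (ha : P.affineRoot a ∈ wallCone b θ) : ∃ c ∈ walls b θ, 0 < P.pairing a.1 c.1 := by
  by_contra! H
  have key : ∀ f ∈ wallCone b θ, f (P.root a.1) ≤ f 0 := by
    intro f hf
    induction hf using AddSubmonoid.closure_induction with
    | mem f hf =>
      obtain ⟨c, hc, rfl⟩ := hf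
      have h := H c hc
      rw [← inner_root_coroot hP, hP.coroot_eq, inner_smul_right] at h
      have h' : ⟪P.root a.1, P.root c.1⟫_ℝ ≤ 0 :=
        nonpos_of_mul_nonpos_right h (div_pos two_pos (inner_root_self_pos P c.1))
      simp only [affineRoot, inner_zero_right]
      rw [real_inner_comm]
      linarith
    | zero => exact le_rfl
    | add f g _ _ hf hg => exact add_le_add hf hg
  have h := key _ ha
  simp only [affineRoot, inner_zero_right] at h
  have := inner_root_self_pos P a.1
  linarith

/-- Every affine reflection is a product of reflections in the walls of the alcove. -/
lemma affineReflection_mem_closure_walls [FiniteDimensional ℝ V] [P.IsRootSystem]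
    [P.IsCrystallographic] (hP : P.IsEuclidean) (hθ : IsHighestRoot b θ) (a : ι × ℤ) :
    P.affineReflection a ∈ Subgroup.closure (P.affineReflection '' walls b θ) := by
  obtain ⟨x, δ, hδ, hx⟩ := exists_affineRoot_eq_of_mem_walls hθ
  have hxA : x ∈ alcove b θ := mem_alcove_iff.2 fun c hc => hδ.trans_eq (hx c hc).symm
  -- Induction on the value at x in units of δ: reflecting in a wall with positive integral pairing
  -- lowers it by at least δ.
  have key : ∀ (N : ℕ) (a : ι × ℤ), P.affineRoot a ∈ wallCone b θ → P.affineRoot a x ≤ N * δ →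
      P.affineReflection a ∈ Subgroup.closure (P.affineReflection '' walls b θ) := by
    intro N
    induction N with
    | zero =>
      intro a ha h
      have := affineRoot_pos_of_mem_wallCone ha hxA
      simp only [Nat.cast_zero, zero_mul] at h
      linarith
    | succ N ih =>
      intro a ha h
      obtain ⟨c, hc, hac⟩ := exists_mem_walls_pairing_pos hP ha
      have hcm : P.affineReflection c ∈ Subgroup.closure (P.affineReflection '' walls b θ) :=
        Subgroup.subset_closure ⟨c, hc, rfl⟩
      obtain ⟨a', ha'⟩ := exists_affineRoot_comp_affineReflection hP a c
      by_cases hm : P.affineRoot a' ∈ wallCone b θ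
      · have h1 : (1 : ℝ) ≤ P.pairing a.1 c.1 := by
          obtain ⟨z, hz⟩ := P.exists_value (S := ℤ) a.1 c.1
          simp only [algebraMap_int_eq, eq_intCast] at hz
          rw [← hz] at hac ⊢
          exact_mod_cast hac
        have h2 := ih a' hm (by
          rw [ha', affineRoot_affineReflection hP, hx c hc]
          push_cast at h
          nlinarith)
        rw [affineReflection_conj hP ha'] at h2
        have h3 := mul_mem (mul_mem hcm h2) hcm
        have hcc := affineReflection_mul_self hP c
        rw [← mul_assoc, ← mul_assoc, hcc, one_mul, mul_assoc, hcc, mul_one] at h3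
        exact h3
      · rw [affineReflection_eq_of_sign_change hP hθ hc ha' ha hm]
        exact hcm
  have key' : ∀ a : ι × ℤ, P.affineRoot a ∈ wallCone b θ →
      P.affineReflection a ∈ Subgroup.closure (P.affineReflection '' walls b θ) := by
    intro a ha
    obtain ⟨N, hN⟩ := exists_nat_ge (P.affineRoot a x / δ)
    exact key N a ha ((div_le_iff₀ hδ).1 hN)
  rcases affineRoot_mem_or_neg_mem_wallCone hθ a with h | h
  · exact key' a h
  · obtain ⟨a', ha'⟩ := exists_affineRoot_eq_neg (P := P) a
    rw [affineReflection_eq_of_affineRoot_eq_smul hP (c := a') (t := -1)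
      (by rw [ha']; simp)]
    exact key' a' (ha' ▸ h)

lemma affineReflection_mem_affineWeylGroup [P.IsCrystallographic] (a : ι × ℤ) :
    P.affineReflection a ∈ P.affineWeylGroup := by
  refine ⟨?_, ?_⟩
  · have : (P.affineReflection a).linear = P.coreflection a.1 := by
      ext x
      rfl
    rw [this]
    exact Subgroup.subset_closure ⟨_, rfl⟩
  · have : P.affineReflection a 0 = a.2 • P.coroot a.1 := by
      simp [affineReflection, Int.cast_smul_eq_zsmul]
    rw [this]
    exact Submodule.smul_mem _ _ (Submodule.subset_span ⟨_, rfl⟩)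

/-- The affine Weyl group is generated by the affine reflections. -/
lemma affineWeylGroup_eq_closure [P.IsCrystallographic] (hP : P.IsEuclidean) :
    P.affineWeylGroup = Subgroup.closure (Set.range P.affineReflection) := by
  refine le_antisymm ?_ ?_
  · intro g hg
    have hT : ∀ l ∈ P.corootSpan ℤ,
        AffineEquiv.constVAdd ℝ V l ∈ Subgroup.closure (Set.range P.affineReflection) := by
      intro l hl
      induction hl using Submodule.span_induction with
      | mem l hl =>
        obtain ⟨i, rfl⟩ := hl
        -- Translation by a coroot is the product of reflections in two consecutive parallel
        -- hyperplanes.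
        have : AffineEquiv.constVAdd ℝ V (P.coroot i) =
            P.affineReflection (i, 1) * P.affineReflection (i, 0) := by
          ext x
          have h := DFunLike.congr_fun (affineReflection_mul_self hP (i, 0)) x
          change P.affineReflection (i, 0) (P.affineReflection (i, 0) x) = x at h
          change _ = P.affineReflection (i, 1) (P.affineReflection (i, 0) x)
          rw [affineReflection_apply hP] at h
          rw [affineReflection_apply hP]
          have h2 : P.affineRoot (i, 1) (P.affineReflection (i, 0) x) =
            P.affineRoot (i, 0) (P.affineReflection (i, 0) x) - 1 := by simp [affineRoot]
          rw [h2, sub_smul, ← sub_add, h]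
          simp [add_comm]
        rw [this]
        exact mul_mem (Subgroup.subset_closure ⟨_, rfl⟩) (Subgroup.subset_closure ⟨_, rfl⟩)
      | zero =>
        rw [AffineEquiv.constVAdd_zero]
        exact one_mem _
      | add l m _ _ hl hm =>
        rw [AffineEquiv.constVAdd_add]
        exact mul_mem hl hm
      | smul n l _ hl =>
        rw [AffineEquiv.constVAdd_zsmul]
        exact zpow_mem hl n
    have hW : ∀ v ∈ P.weylGroupOnCoweights,
        v.toAffineEquiv ∈ Subgroup.closure (Set.range P.affineReflection) := by
      have hr : ∀ i, (P.coreflection i).toAffineEquiv ∈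
          Subgroup.closure (Set.range P.affineReflection) := by
        intro i
        have : (P.coreflection i).toAffineEquiv = P.affineReflection (i, 0) := by
          ext x
          simp [affineReflection]
        rw [this]
        exact Subgroup.subset_closure ⟨_, rfl⟩
      intro v hv
      unfold weylGroupOnCoweights at hv
      induction hv using Subgroup.closure_induction with
      | mem v hv =>
        obtain ⟨i, rfl⟩ := hv
        exact hr i
      | one => exact one_mem _
      | mul v w _ _ hv hw => exact mul_mem hv hw
      | inv v _ hv => exact inv_mem hv
    have : g = AffineEquiv.constVAdd ℝ V (g 0) * g.linear.toAffineEquiv := by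
      ext x
      have := g.map_vadd 0 x
      simp only [vadd_eq_add, add_zero] at this
      rw [this]
      change _ = g 0 + g.linear x
      exact add_comm _ _
    rw [this]
    exact mul_mem (hT _ hg.2) (hW _ hg.1)
  · rw [Subgroup.closure_le]
    rintro _ ⟨a, rfl⟩
    exact affineReflection_mem_affineWeylGroup a

lemma affineWeylGroup_eq_closure_walls [FiniteDimensional ℝ V] [P.IsRootSystem]
    [P.IsCrystallographic] (hP : P.IsEuclidean) (hθ : IsHighestRoot b θ) :
    P.affineWeylGroup = Subgroup.closure (P.affineReflection '' walls b θ) := by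
  rw [affineWeylGroup_eq_closure hP]
  refine le_antisymm ?_ (Subgroup.closure_mono (Set.image_subset_range _ _))
  rw [Subgroup.closure_le]
  rintro _ ⟨a, rfl⟩
  exact affineReflection_mem_closure_walls hP hθ a

lemma dist_map_of_mem_affineWeylGroup [P.IsCrystallographic] (hP : P.IsEuclidean)
    {g : V ≃ᵃ[ℝ] V} (hg : g ∈ P.affineWeylGroup) (x y : V) : dist (g x) (g y) = dist x y := by
  rw [affineWeylGroup_eq_closure hP] at hg
  induction hg using Subgroup.closure_induction generalizing x y with
  | mem g hg => obtain ⟨a, rfl⟩ := hg; exact dist_affineReflection hP a x y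
  | one => rfl
  | mul g h _ _ hg hh => exact (hg _ _).trans (hh _ _)
  | inv g _ hg =>
    rw [← hg]
    congr 1 <;> exact g.apply_symm_apply _

/-- The affine Weyl group permutes the affine roots. -/
lemma exists_affineRoot_comp [P.IsCrystallographic] (hP : P.IsEuclidean)
    {g : V ≃ᵃ[ℝ] V} (hg : g ∈ P.affineWeylGroup) (a : ι × ℤ) :
    ∃ a', ∀ x, P.affineRoot a' x = P.affineRoot a (g x) := by
  rw [affineWeylGroup_eq_closure hP] at hg
  induction hg using Subgroup.closure_induction_left generalizing a with
  | one => exact ⟨a, fun _ => rfl⟩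
  | mul_left g hg h _ hh =>
    obtain ⟨c, rfl⟩ := hg
    obtain ⟨a', ha'⟩ := exists_affineRoot_comp_affineReflection hP a c
    obtain ⟨a'', ha''⟩ := hh a'
    exact ⟨a'', fun x => (ha'' x).trans (ha' _)⟩
  | inv_mul_cancel g hg h _ hh =>
    obtain ⟨c, rfl⟩ := hg
    rw [affineReflection_inv hP]
    obtain ⟨a', ha'⟩ := exists_affineRoot_comp_affineReflection hP a c
    obtain ⟨a'', ha''⟩ := hh a'
    exact ⟨a'', fun x => (ha'' x).trans (ha' _)⟩

/-- The exchange condition for words in the reflections in the walls of the alcove. -/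
lemma exists_shorter_word [FiniteDimensional ℝ V] [P.IsRootSystem]
    [P.IsCrystallographic] (hP : P.IsEuclidean) (hθ : IsHighestRoot b θ) {x : V}
    (hx : x ∈ alcove b θ) (L : List (ι × ℤ)) (hL : ∀ c ∈ L, c ∈ walls b θ) (a : ι × ℤ)
    (ha : 0 < P.affineRoot a x) (ha' : P.affineRoot a ((L.map P.affineReflection).prod x) < 0) :
    ∃ L' : List (ι × ℤ), (∀ c ∈ L', c ∈ walls b θ) ∧ L'.length < L.length ∧
      P.affineReflection a * (L.map P.affineReflection).prod =
        (L'.map P.affineReflection).prod := by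
  induction L generalizing a with
  | nil => exact absurd ha (not_lt.2 ha'.le)
  | cons c L ih =>
    have hc : c ∈ walls b θ := hL c (by simp)
    have hL' : ∀ d ∈ L, d ∈ walls b θ := fun d hd => hL d (by simp [hd])
    obtain ⟨a', h⟩ := exists_affineRoot_comp_affineReflection hP a c
    -- If `a'` is still positive, the sign change occurs in the tail. Otherwise `a` and `c` have the
    -- same reflection, which cancels the first letter.
    by_cases hm : P.affineRoot a' ∈ wallCone b θ
    · obtain ⟨M, hM, hlen, hprod⟩ := ih hL' a' (affineRoot_pos_of_mem_wallCone hm hx)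
        (by rw [h]; exact ha')
      refine ⟨c :: M, by simpa [hc] using hM, by simpa using hlen, ?_⟩
      rw [List.map_cons, List.prod_cons, List.map_cons, List.prod_cons, ← hprod,
        affineReflection_conj hP h]
      have hcc := affineReflection_mul_self hP c
      simp only [← mul_assoc, hcc, one_mul]
    · refine ⟨L, hL', by simp, ?_⟩
      rw [affineReflection_eq_of_sign_change hP hθ hc h (mem_wallCone_of_pos hθ hx ha) hm,
        List.map_cons, List.prod_cons, ← mul_assoc, affineReflection_mul_self hP, one_mul]

/-- The affine Weyl group acts freely on alcoves. -/
lemma eq_one_of_mem_alcove [FiniteDimensional ℝ V] [P.IsRootSystem]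
    [P.IsCrystallographic] (hP : P.IsEuclidean) (hθ : IsHighestRoot b θ) {x : V}
    (hx : x ∈ alcove b θ) {g : V ≃ᵃ[ℝ] V} (hg : g ∈ P.affineWeylGroup)
    (hgx : g x ∈ alcove b θ) : g = 1 := by
  have key : ∀ (n : ℕ) (L : List (ι × ℤ)), L.length = n → (∀ c ∈ L, c ∈ walls b θ) →
      (L.map P.affineReflection).prod x ∈ alcove b θ → (L.map P.affineReflection).prod = 1 := by
    intro n
    induction n using Nat.strong_induction_on with
    | _ n ih =>
      rintro (_ | ⟨c, L⟩) hn hL h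
      · simp
      · have hc : c ∈ walls b θ := hL c (by simp)
        have hL' : ∀ d ∈ L, d ∈ walls b θ := fun d hd => hL d (by simp [hd])
        -- The full word ends on the positive side of `c`, so its tail ends on the negative side,
        -- and exchange shortens the word.
        have hneg : P.affineRoot c ((L.map P.affineReflection).prod x) < 0 := by
          have h1 := mem_alcove_iff.1 h c hc
          rw [List.map_cons, List.prod_cons] at h1
          change 0 < P.affineRoot c (P.affineReflection c _) at h1
          rw [affineRoot_affineReflection_self hP] at h1
          exact neg_pos.1 h1
        obtain ⟨M, hM, hlen, hprod⟩ := exists_shorter_word hP hθ hx L hL' c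
          (mem_alcove_iff.1 hx c hc) hneg
        rw [List.map_cons, List.prod_cons, hprod] at h ⊢
        exact ih M.length (by simp at hn; omega) M rfl hM h
  have hw : ∃ L : List (ι × ℤ), (∀ c ∈ L, c ∈ walls b θ) ∧
      g = (L.map P.affineReflection).prod := by
    clear hgx
    rw [affineWeylGroup_eq_closure_walls hP hθ] at hg
    induction hg using Subgroup.closure_induction_left with
    | one => exact ⟨[], by simp, by simp⟩
    | mul_left g hg h _ hh =>
      obtain ⟨c, hc, rfl⟩ := hg
      obtain ⟨L, hL, rfl⟩ := hh
      exact ⟨c :: L, by simpa [hc] using hL, by simp⟩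
    | inv_mul_cancel g hg h _ hh =>
      obtain ⟨c, hc, rfl⟩ := hg
      obtain ⟨L, hL, rfl⟩ := hh
      exact ⟨c :: L, by simpa [hc] using hL, by simp [affineReflection_inv hP]⟩
  obtain ⟨L, hL, rfl⟩ := hw
  exact key _ L rfl hL hgx

end AffineWeylGroup

/-! ### Nearest points of orbits and the folding inequality -/

section Folding

variable {ι V : Type*} [NormedAddCommGroup V] [InnerProductSpace ℝ V]
  {P : RootPairing ι ℝ V V} {b : P.Base} {θ : ι}

/-- The orbits of the affine Weyl group are locally finite. -/
lemma finite_orbit_inter_closedBall [Finite ι] [P.IsRootSystem] [P.IsCrystallographic]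
    (hP : P.IsEuclidean) (b : P.Base) (x y : V) (R : ℝ) :
    {z | (∃ g ∈ P.affineWeylGroup, g y = z) ∧ dist x z ≤ R}.Finite := by
  let B : b.support → ℝ := fun i => ‖P.root i‖ * (R + ‖x‖)
  -- On the orbit, a simple root takes values in the finitely many classes ⟨α_j, y⟩ + ℤ; in a ball
  -- these values are bounded, and simple roots separate points.
  let F : b.support → Set ℝ := fun i =>
    ⋃ j : ι, (fun k : ℤ => ⟪P.root j, y⟫_ℝ - k) ''
      Set.Icc ⌈⟪P.root j, y⟫_ℝ - B i⌉ ⌊⟪P.root j, y⟫_ℝ + B i⌋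
  have hF : ∀ i, (F i).Finite := fun i =>
    Set.finite_iUnion fun j => (Set.finite_Icc _ _).image _
  have hinj : Function.Injective fun (z : V) (i : b.support) => ⟪P.root i, z⟫_ℝ :=
    fun z z' h => eq_of_inner_root_eq b fun i hi => congrFun h ⟨i, hi⟩
  refine ((Set.Finite.pi' hF).preimage hinj.injOn).subset ?_
  rintro z ⟨⟨g, hg, rfl⟩, hz⟩ i
  obtain ⟨⟨j, k⟩, h⟩ := exists_affineRoot_comp hP hg (i, 0)
  have h := h y
  simp only [affineRoot, Int.cast_zero, sub_zero] at h
  have hB : |⟪P.root i, g y⟫_ℝ| ≤ B i := by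
    refine (abs_real_inner_le_norm _ _).trans ?_
    refine mul_le_mul_of_nonneg_left ?_ (norm_nonneg _)
    have := norm_sub_norm_le (g y) x
    rw [dist_comm, dist_eq_norm] at hz
    linarith
  rw [← h, abs_le] at hB
  refine Set.mem_iUnion.2 ⟨j, k, ⟨Int.ceil_le.2 (by linarith), Int.le_floor.2 (by linarith)⟩, h⟩

/-- The squared distance changes by 4 c(x) c(z) / ⟨α, α⟩, which is negative. -/
lemma dist_affineReflection_lt (hP : P.IsEuclidean) (c : ι × ℤ) {x z : V}
    (hx : 0 < P.affineRoot c x) (hz : P.affineRoot c z < 0) :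
    dist x (P.affineReflection c z) < dist x z := by
  have hr := inner_root_self_pos P c.1
  have h1 : x - P.affineReflection c z =
      (x - z) + (P.affineRoot c z * (2 / ⟪P.root c.1, P.root c.1⟫_ℝ)) • P.root c.1 := by
    rw [affineReflection_apply hP, hP.coroot_eq, smul_smul]
    abel
  have h2 : ⟪x - z, P.root c.1⟫_ℝ = P.affineRoot c x - P.affineRoot c z := by
    rw [real_inner_comm, inner_sub_right]
    simp [affineRoot]
  rw [dist_eq_norm, dist_eq_norm]
  refine lt_of_pow_lt_pow_left₀ 2 (norm_nonneg _) ?_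
  have h3 : ‖x - P.affineReflection c z‖ ^ 2 = ‖x - z‖ ^ 2 +
      4 / ⟪P.root c.1, P.root c.1⟫_ℝ * (P.affineRoot c x * P.affineRoot c z) := by
    rw [h1, norm_add_sq_real, ← real_inner_self_eq_norm_sq (_ • _), inner_smul_left,
      inner_smul_right, inner_smul_right, h2]
    simp only [conj_trivial]
    field_simp
    ring
  rw [h3]
  have := mul_neg_of_pos_of_neg hx hz
  have := mul_neg_of_pos_of_neg (div_pos (four_pos (α := ℝ)) hr) this
  linarith

/-- In every orbit of the affine Weyl group, a point which is nearest to a given point of the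
alcove is in the closed alcove. -/
lemma exists_nearest_mem_closedAlcove [Finite ι] [P.IsRootSystem] [P.IsCrystallographic]
    (hP : P.IsEuclidean) {x : V} (hx : x ∈ alcove b θ) (y : V) :
    ∃ g ∈ P.affineWeylGroup, g y ∈ closedAlcove b θ ∧
      ∀ w ∈ P.affineWeylGroup, dist x (g y) ≤ dist x (w y) := by
  obtain ⟨z, ⟨⟨g, hg, rfl⟩, hz⟩, hmin⟩ := Set.exists_min_image _ (dist x)
    (finite_orbit_inter_closedBall hP b x y (dist x y)) ⟨y, ⟨1, one_mem _, rfl⟩, le_rfl⟩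
  have hmin' : ∀ w ∈ P.affineWeylGroup, dist x (g y) ≤ dist x (w y) := by
    intro w hw
    by_cases h : dist x (w y) ≤ dist x y
    · exact hmin _ ⟨⟨w, hw, rfl⟩, h⟩
    · exact hz.trans (not_le.1 h).le
  refine ⟨g, hg, fun c hc => ?_, hmin'⟩
  by_contra! H
  exact (dist_affineReflection_lt hP c (mem_alcove_iff.1 hx c hc) H).not_ge
    (hmin' (P.affineReflection c * g) (mul_mem (affineReflection_mem_affineWeylGroup c) hg))

lemma mem_stiefelDiagram_iff {x : V} : x ∈ P.stiefelDiagram ↔ ∃ a, P.affineRoot a x = 0 := by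
  simp [stiefelDiagram, affineRoot, sub_eq_zero]

lemma mem_alcove_of_notMem_stiefelDiagram {x : V} (hx : x ∈ closedAlcove b θ)
    (hD : x ∉ P.stiefelDiagram) : x ∈ alcove b θ :=
  mem_alcove_iff.2 fun c hc => (hx c hc).lt_of_ne' fun h => hD (mem_stiefelDiagram_iff.2 ⟨c, h⟩)

lemma notMem_stiefelDiagram_of_mem_alcove (hθ : IsHighestRoot b θ) {x : V}
    (hx : x ∈ alcove b θ) : x ∉ P.stiefelDiagram := fun h => by
  obtain ⟨a, ha⟩ := mem_stiefelDiagram_iff.1 h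
  exact affineRoot_ne_zero_of_mem_alcove hθ a hx ha

lemma map_notMem_stiefelDiagram [P.IsCrystallographic] (hP : P.IsEuclidean) {g : V ≃ᵃ[ℝ] V}
    (hg : g ∈ P.affineWeylGroup) {x : V} (hx : x ∉ P.stiefelDiagram) :
    g x ∉ P.stiefelDiagram := fun h => by
  obtain ⟨a, ha⟩ := mem_stiefelDiagram_iff.1 h
  obtain ⟨a', ha'⟩ := exists_affineRoot_comp hP hg a
  exact hx (mem_stiefelDiagram_iff.2 ⟨a', (ha' x).trans ha⟩)

lemma neg_notMem_stiefelDiagram {x : V} (hx : x ∉ P.stiefelDiagram) :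
    -x ∉ P.stiefelDiagram := by
  rintro ⟨i, k, h⟩
  refine hx ⟨i, -k, ?_⟩
  rw [inner_neg_right] at h
  push_cast
  linarith

lemma isClosed_closedAlcove : IsClosed (closedAlcove b θ) := by
  simp only [closedAlcove, Set.ofPred_forall]
  exact isClosed_biInter fun c _ => isClosed_le continuous_const (continuous_affineRoot c)

lemma isOpen_alcove : IsOpen (alcove b θ) := by
  have : alcove b θ = (⋂ i ∈ b.support, {x | 0 < ⟪P.root i, x⟫_ℝ}) ∩ {x | ⟪P.root θ, x⟫_ℝ < 1} := by
    ext x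
    simp [alcove]
  rw [this]
  refine IsOpen.inter (isOpen_biInter_finset fun i _ => ?_) ?_
  · exact isOpen_lt continuous_const (by fun_prop)
  · exact isOpen_lt (by fun_prop) continuous_const

lemma closure_alcove [FiniteDimensional ℝ V] [P.IsRootSystem] (hθ : IsHighestRoot b θ) :
    closure (alcove b θ) = closedAlcove b θ := by
  refine (closure_minimal alcove_subset_closedAlcove isClosed_closedAlcove).antisymm ?_
  intro x hx
  obtain ⟨y, hy⟩ := alcove_nonempty hθ
  have h : openSegment ℝ x y ⊆ alcove b θ := by
    rintro _ ⟨s, t, hs, ht, hst, rfl⟩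
    rw [mem_alcove_iff] at hy ⊢
    intro c hc
    rw [affineRoot_smul_add_smul c hst]
    have := hx c hc
    have := hy c hc
    positivity
  refine closure_mono h ?_
  rw [closure_openSegment]
  exact left_mem_segment ℝ x y

lemma continuous_of_mem_affineWeylGroup [P.IsCrystallographic] (hP : P.IsEuclidean)
    {g : V ≃ᵃ[ℝ] V} (hg : g ∈ P.affineWeylGroup) : Continuous g :=
  (Isometry.of_dist_eq (dist_map_of_mem_affineWeylGroup hP hg)).continuous

/-- Folding the space onto the closed alcove does not increase distances. -/
lemma dist_le_dist_of_mem_closedAlcove [Finite ι] [FiniteDimensional ℝ V] [P.IsRootSystem]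
    [P.IsCrystallographic] (hP : P.IsEuclidean) (hθ : IsHighestRoot b θ) {x y : V}
    (hx : x ∈ closedAlcove b θ) (hy : y ∈ closedAlcove b θ) {w w' : V ≃ᵃ[ℝ] V}
    (hw : w ∈ P.affineWeylGroup) (hw' : w' ∈ P.affineWeylGroup) :
    dist x y ≤ dist (w x) (w' y) := by
  have hcl : IsClosed {p : V × V | dist p.1 p.2 ≤ dist (w p.1) (w' p.2)} :=
    isClosed_le continuous_dist
      (((continuous_of_mem_affineWeylGroup hP hw).comp continuous_fst).dist
        ((continuous_of_mem_affineWeylGroup hP hw').comp continuous_snd))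
  -- Freeness is available only on the open alcove; both sides are continuous, so the closed case
  -- follows by density.
  have hsub : alcove b θ ×ˢ alcove b θ ⊆ {p : V × V | dist p.1 p.2 ≤ dist (w p.1) (w' p.2)} := by
    rintro ⟨x, y⟩ ⟨hx, hy⟩
    obtain ⟨g, hg, hgy, hmin⟩ := exists_nearest_mem_closedAlcove (θ := θ) hP hx y
    obtain rfl : g = 1 := eq_one_of_mem_alcove hP hθ hy hg
      (mem_alcove_of_notMem_stiefelDiagram hgy
        (map_notMem_stiefelDiagram hP hg (notMem_stiefelDiagram_of_mem_alcove hθ hy)))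
    have h := hmin (w⁻¹ * w') (mul_mem (inv_mem hw) hw')
    have hww : w ((w⁻¹ * w') y) = w' y := w.apply_symm_apply _
    rw [← dist_map_of_mem_affineWeylGroup hP hw x ((w⁻¹ * w') y), hww] at h
    exact h
  have := closure_minimal hsub hcl
  rw [closure_prod_eq, closure_alcove hθ] at this
  exact this (Set.mk_mem_prod hx hy)

end Folding

/-! ### Disjointness, covering and the Stiefel diagram -/

section Tiling

variable {ι V : Type*} [NormedAddCommGroup V] [InnerProductSpace ℝ V]
  [FiniteDimensional ℝ V] {P : RootPairing ι ℝ V V} [P.IsRootSystem] [P.IsCrystallographic]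
  {b : P.Base} {θ : ι}

lemma tile_zero_eq_connectedComponentIn (hP : P.IsEuclidean) (hθ : IsHighestRoot b θ)
    {w : V ≃ᵃ[ℝ] V} (hw : w ∈ P.affineWeylGroup) {x : V} (hx : x ∈ alcove b θ) :
    -(w x) ∈ P.stiefelDiagramᶜ ∧
      tile b θ 0 w = connectedComponentIn P.stiefelDiagramᶜ (-(w x)) := by
  let e : V ≃ₜ V := Homeomorph.trans
    { w.toEquiv with
      continuous_toFun := continuous_of_mem_affineWeylGroup hP hw
      continuous_invFun := continuous_of_mem_affineWeylGroup hP (inv_mem hw) } (Homeomorph.neg V)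
  have he : ∀ y, e y = -(w y) := fun _ => rfl
  have htile : tile b θ 0 w = e '' alcove b θ := by
    refine Set.image_congr fun y _ => ?_
    simp [he]
  have hsub : e '' alcove b θ ⊆ P.stiefelDiagramᶜ := by
    rintro _ ⟨y, hy, rfl⟩
    exact neg_notMem_stiefelDiagram
      (map_notMem_stiefelDiagram hP hw (notMem_stiefelDiagram_of_mem_alcove hθ hy))
  have hxe : -(w x) ∈ e '' alcove b θ := ⟨x, hx, rfl⟩
  refine ⟨hsub hxe, ?_⟩
  rw [htile]
  refine Set.Subset.antisymm ?_ ?_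
  · exact (convex_alcove.isPreconnected.image _ e.continuous.continuousOn)
      |>.subset_connectedComponentIn hxe hsub
  -- The tile is open, and its boundary points lie in the diagram, so the component cannot leave it.
  · refine isPreconnected_connectedComponentIn.subset_of_closure_inter_subset
      (e.isOpenMap _ isOpen_alcove) ⟨_, mem_connectedComponentIn (hsub hxe), hxe⟩ ?_
    rintro z ⟨hz, hz'⟩
    rw [← e.image_closure, closure_alcove hθ] at hz
    obtain ⟨y, hy, rfl⟩ := hz
    refine ⟨y, mem_alcove_of_notMem_stiefelDiagram hy fun hyD => ?_, rfl⟩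
    have h1 := connectedComponentIn_subset _ _ hz'
    have h2 := map_notMem_stiefelDiagram hP (inv_mem hw) (neg_notMem_stiefelDiagram h1)
    rw [he, neg_neg] at h2
    exact h2 ((w.symm_apply_apply y).symm ▸ hyD)

variable [Finite ι]

lemma disjoint_tile (hP : P.IsEuclidean) (hθ : IsHighestRoot b θ) {S : V →L[ℝ] V} (hS : ‖S‖ < 1)
    {w w' : V ≃ᵃ[ℝ] V} (hw : w ∈ P.affineWeylGroup) (hw' : w' ∈ P.affineWeylGroup)
    (hne : w ≠ w') : Disjoint (tile b θ S w) (tile b θ S w') := by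
  rw [Set.disjoint_left]
  rintro _ ⟨x, hx, rfl⟩ ⟨y, hy, h⟩
  dsimp only at h
  have h1 := dist_le_dist_of_mem_closedAlcove hP hθ (alcove_subset_closedAlcove hx)
    (alcove_subset_closedAlcove hy) hw hw'
  have h2 : w x - w' y = S (x - y) := by
    rw [map_sub]
    rw [sub_eq_sub_iff_add_eq_add] at h ⊢
    rw [add_comm, h]
  rw [dist_eq_norm, dist_eq_norm, h2] at h1
  have h3 := S.le_opNorm (x - y)
  have h4 : ‖x - y‖ = 0 := by nlinarith [norm_nonneg (x - y)]
  obtain rfl : x = y := sub_eq_zero.1 (norm_eq_zero.1 h4)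
  rw [sub_self, map_zero, sub_eq_zero] at h2
  have h5 : w'⁻¹ * w = 1 := by
    refine eq_one_of_mem_alcove hP hθ hx (mul_mem (inv_mem hw') hw) ?_
    have : (w'⁻¹ * w) x = x := (congrArg w'.symm h2).trans (w'.symm_apply_apply x)
    rwa [this]
  exact hne (inv_mul_eq_one.1 h5).symm

lemma iUnion_closure_tile (hP : P.IsEuclidean) (hθ : IsHighestRoot b θ) {S : V →L[ℝ] V}
    (hS : ‖S‖ < 1) : ⋃ w ∈ P.affineWeylGroup, closure (tile b θ S w) = Set.univ := by
  refine Set.eq_univ_of_forall fun v => ?_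
  obtain ⟨x₀, hx₀⟩ := alcove_nonempty hθ
  have hfold : ∀ y : V, ∃ x ∈ closedAlcove b θ, ∃ w ∈ P.affineWeylGroup, w x = y := by
    intro y
    obtain ⟨g, hg, hgy, -⟩ := exists_nearest_mem_closedAlcove hP hx₀ y
    exact ⟨g y, hgy, g⁻¹, inv_mem hg, g.symm_apply_apply y⟩
  choose π hπ w hw hwπ using hfold
  -- `π` is 1-Lipschitz by the folding inequality, whatever choices of `w` were made.
  have hT : ContractingWith ‖S‖₊ fun y => S (π y) - v := by
    refine ⟨by exact_mod_cast hS, LipschitzWith.of_dist_le_mul fun y y' => ?_⟩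
    rw [dist_sub_right, dist_eq_norm, ← map_sub]
    refine (S.le_opNorm _).trans (mul_le_mul_of_nonneg_left ?_ (norm_nonneg _))
    rw [← dist_eq_norm]
    refine (dist_le_dist_of_mem_closedAlcove hP hθ (hπ y) (hπ y') (hw y) (hw y')).trans_eq ?_
    rw [hwπ, hwπ]
  have : CompleteSpace V := FiniteDimensional.complete ℝ V
  have : Nonempty V := ⟨0⟩
  obtain ⟨y, hy⟩ : ∃ y, S (π y) - v = y := ⟨_, hT.fixedPoint_isFixedPt⟩
  have hv : v = S (π y) - w y (π y) := by rw [hwπ, eq_sub_iff_add_eq, ← eq_sub_iff_add_eq', hy]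
  refine Set.mem_iUnion₂.2 ⟨w y, hw y, ?_⟩
  have hcont : Continuous fun x => S x - w y x :=
    S.continuous.sub (continuous_of_mem_affineWeylGroup hP (hw y))
  rw [hv]
  refine image_closure_subset_closure_image hcont ⟨π y, ?_, rfl⟩
  rw [closure_alcove hθ]
  exact hπ y

lemma setOf_tile_zero (hP : P.IsEuclidean) (hθ : IsHighestRoot b θ) :
    {T : Set V | ∃ w ∈ P.affineWeylGroup, T = tile b θ 0 w} =
      {T : Set V | ∃ x ∈ P.stiefelDiagramᶜ, T = connectedComponentIn P.stiefelDiagramᶜ x} := by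
  obtain ⟨x₀, hx₀⟩ := alcove_nonempty hθ
  ext T
  constructor
  · rintro ⟨w, hw, rfl⟩
    exact ⟨_, tile_zero_eq_connectedComponentIn hP hθ hw hx₀⟩
  · rintro ⟨x, hx, rfl⟩
    -- Fold -x rather than x, since the tiles for S = 0 are -w(A).
    obtain ⟨g, hg, hgx, -⟩ := exists_nearest_mem_closedAlcove hP hx₀ (-x)
    have hA : g (-x) ∈ alcove b θ := mem_alcove_of_notMem_stiefelDiagram hgx
      (map_notMem_stiefelDiagram hP hg (neg_notMem_stiefelDiagram hx))
    have h := (tile_zero_eq_connectedComponentIn hP hθ (inv_mem hg) hA).2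
    have hx' : -(g⁻¹ (g (-x))) = x := by
      rw [show g⁻¹ (g (-x)) = -x from g.symm_apply_apply _, neg_neg]
    rw [hx'] at h
    exact ⟨g⁻¹, inv_mem hg, h.symm⟩

end Tiling

/-! ### Simplices, boundedness and the limit τ → 1 -/

section Simplex

/-- The points with positive barycentric coordinates form the interior of a simplex. -/
lemma _root_.Affine.Simplex.exists_interior_eq {V : Type*} [AddCommGroup V] [Module ℝ V] {n : ℕ}
    (φ : Fin (n + 1) → V →ᵃ[ℝ] ℝ) (p : Fin (n + 1) → V)
    (hφ : ∀ i j, φ i (p j) = if i = j then 1 else 0) (hsum : ∀ x, ∑ i, φ i x = 1)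
    (hinj : ∀ x y, (∀ i, φ i x = φ i y) → x = y) :
    ∃ s : Affine.Simplex ℝ V n, s.interior = {x | ∀ i, φ i x ∈ Set.Ioo 0 1} := by
  have key : ∀ (u : Fin (n + 1) → ℝ), ∑ i, u i = 1 → ∀ i,
      φ i (Finset.univ.affineCombination ℝ p u) = u i := by
    intro u hu i
    rw [Finset.map_affineCombination _ _ _ hu,
      Finset.affineCombination_eq_linear_combination _ _ _ hu]
    simp [hφ]
  have hp : AffineIndependent ℝ p := by
    rw [affineIndependent_iff_eq_of_fintype_affineCombination_eq]
    intro u u' hu hu' h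
    ext i
    rw [← key u hu, ← key u' hu', h]
  refine ⟨⟨p, hp⟩, ?_⟩
  ext x
  constructor
  · rintro ⟨u, hu, hu', rfl⟩ i
    rw [key u hu]
    exact hu' i
  · intro hx
    exact ⟨fun i => φ i x, hsum x, hx, hinj _ _ fun i => key _ (hsum x) i⟩

variable {ι V : Type*} [NormedAddCommGroup V] [InnerProductSpace ℝ V]
  [FiniteDimensional ℝ V] {P : RootPairing ι ℝ V V} [P.IsRootSystem] {b : P.Base} {θ : ι}

/-- The barycentric coordinates are 1 - θ and m_i α_i, where θ = ∑ m_i α_i; the vertices are 0 and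
the dual basis vectors divided by m_i. -/
lemma exists_simplex_interior_eq_alcove (hθ : IsHighestRoot b θ) :
    ∃ s : Affine.Simplex ℝ V (Module.finrank ℝ V), s.interior = alcove b θ := by
  classical
  obtain ⟨m, hm, hmθ⟩ := hθ.exists_coeff
  let e : Fin (Module.finrank ℝ V) ≃ b.support :=
    (Fintype.equivFinOfCardEq (Module.finrank_eq_card_basis b.toWeightBasis).symm).symm
  have hpos : 0 < Module.finrank ℝ V := by
    have : Nonempty ι := ⟨θ⟩
    obtain ⟨i, hi⟩ := b.support_nonempty
    exact (e.symm ⟨i, hi⟩).pos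
  have hθe : ∀ x, ∑ i, m (e i) * ⟪P.root (e i), x⟫_ℝ = ⟪P.root θ, x⟫_ℝ := by
    intro x
    rw [e.sum_comp fun i => m i * ⟪P.root i, x⟫_ℝ, hmθ, sum_inner]
    simp [inner_smul_left]
  choose q hq using fun i : b.support =>
    exists_inner_root_eq (P := P) (b := b) fun j => if j = i then (m i)⁻¹ else 0
  let φ : Fin (Module.finrank ℝ V + 1) → V →ᵃ[ℝ] ℝ :=
    Fin.cons (AffineMap.const ℝ V 1 - (innerₗ V (P.root θ)).toAffineMap)
      fun i => m (e i) • (innerₗ V (P.root (e i))).toAffineMap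
  have hφ0 : ∀ x, φ 0 x = 1 - ⟪P.root θ, x⟫_ℝ := fun x => by simp [φ]
  have hφs : ∀ i x, φ (Fin.succ i) x = m (e i) * ⟪P.root (e i), x⟫_ℝ := fun i x => by simp [φ]
  have hsum : ∀ x, ∑ i, φ i x = 1 := by
    intro x
    rw [Fin.sum_univ_succ, hφ0]
    simp only [hφs, hθe, sub_add_cancel]
  obtain ⟨s, hs⟩ := Affine.Simplex.exists_interior_eq φ (Fin.cons 0 fun i => q (e i)) (by
      intro i j
      refine Fin.cases ?_ (fun j => ?_) j <;> refine Fin.cases ?_ (fun i => ?_) i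
      · simp [hφ0]
      · simp [hφs]
      · rw [hφ0, ← hθe, if_neg (Fin.succ_ne_zero _).symm]
        simp [hq, (hm _).ne']
      · rw [hφs]
        by_cases hij : i = j
        · subst hij
          simp [hq, (hm _).ne']
        · simp [hq, hij]) hsum (by
      intro x y h
      refine eq_of_inner_root_eq b fun i hi => ?_
      have := h (Fin.succ (e.symm ⟨i, hi⟩))
      rw [hφs, hφs, e.apply_symm_apply] at this
      exact mul_left_cancel₀ (hm _).ne' this)
  refine ⟨s, hs.trans ?_⟩
  ext x
  have hiff : x ∈ alcove b θ ↔ ∀ i, 0 < φ i x := by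
    rw [Fin.forall_fin_succ, hφ0, sub_pos, and_comm]
    refine and_congr ?_ Iff.rfl
    simp only [hφs, mul_pos_iff_of_pos_left (hm _)]
    rw [e.forall_congr_left]
    simp
  rw [hiff]
  refine ⟨fun h i => (h i).1, fun h i => ⟨h i, ?_⟩⟩
  -- A coordinate is below 1 because another one is positive; this needs dimension at least 1.
  have : Nontrivial (Fin (Module.finrank ℝ V + 1)) := Fin.nontrivial_iff_two_le.2 (by omega)
  obtain ⟨j, hj⟩ := exists_ne i
  rw [← hsum x, ← Finset.add_sum_erase _ _ (Finset.mem_univ i)]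
  have : 0 < ∑ k ∈ Finset.univ.erase i, φ k x :=
    Finset.sum_pos (fun k _ => h k) ⟨j, by simp [hj]⟩
  linarith

lemma isBounded_alcove (hθ : IsHighestRoot b θ) : Bornology.IsBounded (alcove b θ) := by
  obtain ⟨s, hs⟩ := exists_simplex_interior_eq_alcove hθ
  rw [← hs]
  have hb : Bornology.IsBounded (convexHull ℝ (Set.range s.points)) :=
    isBounded_convexHull.2 (Set.finite_range _).isBounded
  refine hb.subset ?_
  rintro _ ⟨u, hu, hu', rfl⟩
  exact affineCombination_mem_convexHull (fun i _ => (hu' i).1.le) hu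

lemma exists_simplex_interior_eq_tile [P.IsCrystallographic] (hP : P.IsEuclidean)
    (hθ : IsHighestRoot b θ) {S : V →L[ℝ] V} (hS : ‖S‖ < 1) {w : V ≃ᵃ[ℝ] V}
    (hw : w ∈ P.affineWeylGroup) :
    ∃ s : Affine.Simplex ℝ V (Module.finrank ℝ V), tile b θ S w = s.interior := by
  obtain ⟨s, hs⟩ := exists_simplex_interior_eq_alcove hθ
  let f : V →ᵃ[ℝ] V := (S : V →ₗ[ℝ] V).toAffineMap - (w : V →ᵃ[ℝ] V)
  have hf : Function.Injective f := by
    intro x y h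
    have h : S x - w x = S y - w y := h
    have h1 : w x - w y = S (x - y) := by
      rw [map_sub]
      rw [sub_eq_sub_iff_add_eq_add] at h ⊢
      rw [h, add_comm]
    have h2 := dist_map_of_mem_affineWeylGroup hP hw x y
    rw [dist_eq_norm, dist_eq_norm, h1] at h2
    have h3 := S.le_opNorm (x - y)
    have h4 : ‖x - y‖ = 0 := by nlinarith [norm_nonneg (x - y)]
    exact sub_eq_zero.1 (norm_eq_zero.1 h4)
  refine ⟨s.map f hf, ?_⟩
  rw [Affine.Simplex.interior_map, hs]
  rfl

lemma eventually_hausdorffEDist_tile_lt (hθ : IsHighestRoot b θ) {ε : ENNReal} (hε : 0 < ε) :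
    ∀ᶠ τ : ℝ in 𝓝[<] 1, ∀ w : V ≃ᵃ[ℝ] V,
      Metric.hausdorffEDist (tile b θ (τ • ContinuousLinearMap.id ℝ V) w)
        (tile b θ (ContinuousLinearMap.id ℝ V) w) < ε := by
  obtain ⟨R, hR⟩ := (isBounded_alcove hθ).exists_norm_le
  have ht : Filter.Tendsto (fun τ : ℝ => ENNReal.ofReal (|τ - 1| * R)) (𝓝[<] 1) (𝓝 0) := by
    have hc : Continuous fun τ : ℝ => ENNReal.ofReal (|τ - 1| * R) :=
      ENNReal.continuous_ofReal.comp (by fun_prop)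
    simpa using (hc.tendsto 1).mono_left nhdsWithin_le_nhds
  filter_upwards [ht.eventually_lt_const hε] with τ hτ w
  -- The term w x cancels, which makes the bound uniform in `w`.
  have h : ∀ x ∈ alcove b θ, edist ((τ • ContinuousLinearMap.id ℝ V) x - w x)
      (ContinuousLinearMap.id ℝ V x - w x) ≤ ENNReal.ofReal (|τ - 1| * R) := by
    intro x hx
    rw [edist_dist, dist_sub_right, dist_eq_norm]
    refine ENNReal.ofReal_le_ofReal ?_
    have : (τ • ContinuousLinearMap.id ℝ V) x - ContinuousLinearMap.id ℝ V x = (τ - 1) • x := by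
      simp [sub_smul]
    rw [this, norm_smul, Real.norm_eq_abs]
    exact mul_le_mul_of_nonneg_left (hR x hx) (abs_nonneg _)
  refine (Metric.hausdorffEDist_le_of_mem_edist ?_ ?_).trans_lt hτ
  · rintro _ ⟨x, hx, rfl⟩
    exact ⟨_, ⟨x, hx, rfl⟩, h x hx⟩
  · rintro _ ⟨x, hx, rfl⟩
    exact ⟨_, ⟨x, hx, rfl⟩, by rw [edist_comm]; exact h x hx⟩

end Simplex

end RootPairing

theorem theorem3 {ι V : Type*} [Finite ι]
    [NormedAddCommGroup V] [InnerProductSpace ℝ V] [FiniteDimensional ℝ V]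
    (P : RootPairing ι ℝ V V) [P.IsRootSystem] [P.IsCrystallographic] [P.IsReduced]
    [P.IsIrreducible] (hP : P.IsEuclidean)
    (b : P.Base) (θ : ι) (hθ : RootPairing.IsHighestRoot b θ) :
    -- the tiles for a given `S` with `‖S‖ < 1`
    (∀ S : V →L[ℝ] V, ‖S‖ < 1 →
      (∀ w ∈ P.affineWeylGroup, ∃ s : Affine.Simplex ℝ V (Module.finrank ℝ V),
        RootPairing.tile b θ S w = s.interior) ∧
      (∀ w ∈ P.affineWeylGroup, ∀ w' ∈ P.affineWeylGroup, w ≠ w' →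
        Disjoint (RootPairing.tile b θ S w) (RootPairing.tile b θ S w')) ∧
      (⋃ w ∈ P.affineWeylGroup, closure (RootPairing.tile b θ S w)) = Set.univ) ∧
    -- for `S = 0` the tiles are the connected components of the complement of the Stiefel diagram
    {T : Set V | ∃ w ∈ P.affineWeylGroup, T = RootPairing.tile b θ 0 w} =
      {T : Set V | ∃ x ∈ (P.stiefelDiagram)ᶜ, T = connectedComponentIn (P.stiefelDiagram)ᶜ x} ∧
    -- for `S = τ • id` with `τ → 1` from below, the tiles converge to the sets `(id - w)(A)`
    (∀ ε : ENNReal, 0 < ε → ∀ᶠ τ : ℝ in 𝓝[<] 1, ∀ w ∈ P.affineWeylGroup,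
      Metric.hausdorffEDist (RootPairing.tile b θ (τ • ContinuousLinearMap.id ℝ V) w)
        (RootPairing.tile b θ (ContinuousLinearMap.id ℝ V) w) < ε) := by
  exact ⟨fun S hS => ⟨fun w hw => RootPairing.exists_simplex_interior_eq_tile hP hθ hS hw,
      fun w hw w' hw' hne => RootPairing.disjoint_tile hP hθ hS hw hw' hne,
      RootPairing.iUnion_closure_tile hP hθ hS⟩,
    RootPairing.setOf_tile_zero hP hθ,
    fun ε hε => (RootPairing.eventually_hausdorffEDist_tile_lt hθ hε).mono fun τ h w _ => h w⟩
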